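/- Let $(\mathcal K,[\cdot,\cdot])$ be a (complex) Krein space, let $\|\cdot\|$ be a Banach space norm on $\mathcal K$ with respect to which $[\cdot,\cdot]$ is continuous, and let $T$ be a closed, densely defined linear operator in $\mathcal K$. Let $T^{[*]}$ be its adjoint with respect to $[\cdot,\cdot]$, and let $T^{[*]}T$ and $TT^{[*]}$ have their natural domains. For a linear operator $A$ in $\mathcal K$, $\rho(A)$ is the set of $\lambda\in\mathbb C$ for which $A-\lambda:\operatorname{dom}A\to\mathcal K$ is bijective with bounded inverse, and $\sigma(A)=\mathbb C\setminus\rho(A)$. A point $\lambda\in\sigma(A)$ of a selfadjoint operator $A=A^{[*]}$ is of positive (negative) type if there is a sequence $(x_n)\subset\operatorname{dom}A$ with $\|x_n\|=1$ and $(A-\lambda)x_n\to0$, and every such sequence satisfies $\liminf_n[x_n,x_n]>0$ (resp. $\limsup_n[x_n,x_n]<0$). A set $\Delta$ is of definite type with respect to $A$ if either all points of $\Delta\cap\sigma(A)$ are of positive type or all of them are of negative type. Let $\overline{\mathbb R}=\mathbb R\cup\{\infty\}\subset\overline{\mathbb C}=\mathbb C\cup\{\infty\}$ be the one-point compactifications,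 and let $\Omega\subset\overline{\mathbb C}$ be a domain (open and connected), symmetric with respect to $\overline{\mathbb R}$, with $\Omega\cap\mathbb R\neq\emptyset$ and such that $\Omega\cap\mathbb C^+$ and $\Omega\cap\mathbb C^-$ are simply connected. A selfadjoint operator $A$ in $\mathcal K$ is called definitizable over $\Omega$ if (i) $\sigma(A)\cap(\Omega\setminus\overline{\mathbb R})$ has no accumulation points in $\Omega$ and consists of poles of the resolvent of $A$; (ii) for each closed subset $\Delta$ of $\overline{\mathbb C}$ with $\Delta\subset\Omega\cap\overline{\mathbb R}$ there are an open neighbourhood $\mathcal U$ of $\Delta$ in $\overline{\mathbb C}$ and numbers $m\in\mathbb N$, $m\ge1$, and $M>0$ such that every $\lambda\in\mathcal U\setminus\overline{\mathbb R}$ belongs to $\rho(A)$ and $$\|(A-\lambda)^{-1}\|\le M\,\frac{(1+|\lambda|)^{2m-2}}{|\operatorname{Im}\lambda|^m};$$ (iii) each point $\lambda\in\Omega\cap\overline{\mathbb R}$ has an open connected neighbourhood $I_\lambda$ in $\overline{\mathbb R}$ such that, for each connected component $C$ of $I_\lambda\setminus\{\lambda\}$, the set $C\cap\mathbb R$ is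 of definite type with respect to $A$. Assume that both $T^{[*]}T$ and $TT^{[*]}$ have non-empty resolvent sets. Then $T^{[*]}T$ is definitizable over $\Omega$ if and only if $TT^{[*]}$ is definitizable over $\Omega$; here selfadjointness is understood as part of definitizability over $\Omega$. -/

import Mathlib

noncomputable section

namespace Krein

open Filter Topology

variable {K : Type*} [NormedAddCommGroup K] [NormedSpace ℂ K]

/-! ### Krein spaces -/

/-- `(P, [·,·])` is a Hilbert space: the form is positive definite on `P`, and `P` is complete
for the norm `[x,x]^{1/2}` (Cauchy sequences and limits are expressed through `[x,x]`). -/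
structure IsHilbertSubspace (B : K →ₗ⋆[ℂ] K →ₗ[ℂ] ℂ) (P : Submodule ℂ K) : Prop where
  pos : ∀ x ∈ P, x ≠ 0 → 0 < (B x x).re
  complete : ∀ u : ℕ → K, (∀ n, u n ∈ P) →
    (∀ ε > 0, ∃ N, ∀ m ≥ N, ∀ n ≥ N, (B (u m - u n) (u m - u n)).re < ε) →
    ∃ x ∈ P, Tendsto (fun n => (B (u n - x) (u n - x)).re) atTop (𝓝 0)

/-- `(K, [·,·])` is a Krein space with `[x,y] = B x y`, and the form is continuous for the given
norm of `K`: the form is Hermitian and `K` is the direct orthogonal sum of a Hilbert space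
`(P, [·,·])` and an anti-Hilbert space `(N, [·,·])`. -/
structure IsKreinForm (B : K →ₗ⋆[ℂ] K →ₗ[ℂ] ℂ) : Prop where
  hermitian : ∀ x y, B y x = (starRingEnd ℂ) (B x y)
  continuous : Continuous fun p : K × K => B p.1 p.2
  decomposition : ∃ P N : Submodule ℂ K, IsCompl P N ∧ (∀ x ∈ P, ∀ y ∈ N, B x y = 0) ∧
    IsHilbertSubspace B P ∧ IsHilbertSubspace (-B) N

/-! ### Unbounded operators -/

/-- The product `S T`, with its natural domain `{x ∈ dom T | T x ∈ dom S}`. -/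
def mul (S T : K →ₗ.[ℂ] K) : K →ₗ.[ℂ] K where
  domain := (S.domain.comap T.toFun).map T.domain.subtype
  toFun :=
    { toFun := fun x => S ⟨T ⟨x, by obtain ⟨x, y, hy, rfl⟩ := x; exact y.2⟩,
        by obtain ⟨x, y, hy, rfl⟩ := x; exact hy⟩
      map_add' := fun x y => by
        rw [← LinearPMap.map_add]
        congr 1
        ext
        simp only [Submodule.coe_add]
        rw [← LinearPMap.map_add]
        rfl
      map_smul' := fun c x => by
        rw [RingHom.id_apply, ← LinearPMap.map_smul]
        congr 1
        ext
        simp only [Submodule.coe_smul]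
        rw [← LinearPMap.map_smul]
        rfl }

/-- The graph `{(y, z) | [T x, y] = [x, z] for all x ∈ dom T}` of the adjoint of `T` with respect
to the form `B`. -/
def adjointGraph (B : K →ₗ⋆[ℂ] K →ₗ[ℂ] ℂ) (T : K →ₗ.[ℂ] K) : Submodule ℂ (K × K) where
  carrier := {p | ∀ x : T.domain, B (T x) p.1 = B x p.2}
  zero_mem' := fun x => by simp
  add_mem' := fun {p q} hp hq x => by simp [hp x, hq x]
  smul_mem' := fun c p hp x => by simp [hp x]

/-- The adjoint `T^{[*]}` of a densely defined operator `T` with respect to the form `B`. -/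
def adjoint (B : K →ₗ⋆[ℂ] K →ₗ[ℂ] ℂ) (T : K →ₗ.[ℂ] K) : K →ₗ.[ℂ] K :=
  (adjointGraph B T).toLinearPMap

/-- `A` is densely defined and `A^{[*]} = A`. -/
def IsSelfadjoint (B : K →ₗ⋆[ℂ] K →ₗ[ℂ] ℂ) (A : K →ₗ.[ℂ] K) : Prop :=
  Dense (A.domain : Set K) ∧ adjoint B A = A

/-- `R` is the bounded inverse, defined on all of `K`, of `A - z : dom A → K`. -/
def IsResolventAt (A : K →ₗ.[ℂ] K) (z : ℂ) (R : K →L[ℂ] K) : Prop :=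
  (∀ y, ∃ h : R y ∈ A.domain, A ⟨R y, h⟩ - z • R y = y) ∧
    ∀ x : A.domain, R (A x - z • (x : K)) = x

/-- The resolvent set `ρ(A)`. -/
def resolventSet (A : K →ₗ.[ℂ] K) : Set ℂ := {z | ∃ R : K →L[ℂ] K, IsResolventAt A z R}

/-- The spectrum `σ(A)`. -/
def spectrum (A : K →ₗ.[ℂ] K) : Set ℂ := (resolventSet A)ᶜ

open Classical in
/-- The resolvent `(A - z)⁻¹` for `z ∈ ρ(A)` (and `0` for `z ∈ σ(A)`). -/
def resolvent (A : K →ₗ.[ℂ] K) (z : ℂ) : K →L[ℂ] K :=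
  if h : ∃ R : K →L[ℂ] K, IsResolventAt A z R then h.choose else 0

/-- `z` is a pole of the resolvent of `A`: an isolated point of the spectrum at which the
resolvent has a pole (of some positive order). -/
def IsResolventPole (A : K →ₗ.[ℂ] K) (z : ℂ) : Prop :=
  z ∈ spectrum A ∧ (∀ᶠ w in 𝓝[≠] z, w ∈ resolventSet A) ∧
    MeromorphicAt (resolvent A) z ∧ meromorphicOrderAt (resolvent A) z < 0

/-- `(x n)` is a sequence of unit vectors in `dom A` with `(A - z) x n → 0`. -/
def IsApproxEigenseq (A : K →ₗ.[ℂ] K) (z : ℂ) (x : ℕ → A.domain) : Prop :=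
  (∀ n, ‖(x n : K)‖ = 1) ∧ Tendsto (fun n => A (x n) - z • (x n : K)) atTop (𝓝 0)

/-- The approximate point spectrum. -/
def approxPointSpectrum (A : K →ₗ.[ℂ] K) : Set ℂ := {z | ∃ x, IsApproxEigenseq A z x}

/-- The spectral points of positive type, `σ₊₊(A)`. -/
def posTypeSpectrum (B : K →ₗ⋆[ℂ] K →ₗ[ℂ] ℂ) (A : K →ₗ.[ℂ] K) : Set ℂ :=
  {z | z ∈ spectrum A ∧ z ∈ approxPointSpectrum A ∧ ∀ x, IsApproxEigenseq A z x →
    0 < liminf (fun n => (B (x n : K) (x n : K)).re) atTop}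

/-- The spectral points of negative type, `σ₋₋(A)`. -/
def negTypeSpectrum (B : K →ₗ⋆[ℂ] K →ₗ[ℂ] ℂ) (A : K →ₗ.[ℂ] K) : Set ℂ :=
  {z | z ∈ spectrum A ∧ z ∈ approxPointSpectrum A ∧ ∀ x, IsApproxEigenseq A z x →
    limsup (fun n => (B (x n : K) (x n : K)).re) atTop < 0}

/-- The set `Δ` is of positive type or of negative type with respect to `A`. -/
def IsOfDefiniteType (B : K →ₗ⋆[ℂ] K →ₗ[ℂ] ℂ) (A : K →ₗ.[ℂ] K) (Δ : Set ℂ) : Prop :=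
  Δ ∩ spectrum A ⊆ posTypeSpectrum B A ∨ Δ ∩ spectrum A ⊆ negTypeSpectrum B A

/-! ### Local definitizability -/

/-- The embedding of the extended real line `ℝ ∪ {∞}` into the extended plane `ℂ ∪ {∞}`. -/
def extReal : OnePoint ℝ → OnePoint ℂ := OnePoint.map (fun t : ℝ => (t : ℂ))

/-- The domains over which definitizability is considered: domains in the extended complex plane,
symmetric with respect to the extended real line, that meet `ℝ` and whose intersections with the
open upper and lower half-planes are simply connected. -/
structure IsAdmissibleDomain (Ω : Set (OnePoint ℂ)) : Prop where
  isOpen : IsOpen Ω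
  isConnected : IsConnected Ω
  symm : ∀ z : ℂ, (z : OnePoint ℂ) ∈ Ω → (((starRingEnd ℂ) z : ℂ) : OnePoint ℂ) ∈ Ω
  meets_real : ∃ t : ℝ, ((t : ℂ) : OnePoint ℂ) ∈ Ω
  upper : IsSimplyConnected {z : ℂ | (z : OnePoint ℂ) ∈ Ω ∧ 0 < z.im}
  lower : IsSimplyConnected {z : ℂ | (z : OnePoint ℂ) ∈ Ω ∧ z.im < 0}

/-- The selfadjoint operator `A` is definitizable over `Ω`. -/
structure IsDefinitizableOver (B : K →ₗ⋆[ℂ] K →ₗ[ℂ] ℂ) (A : K →ₗ.[ℂ] K)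
    (Ω : Set (OnePoint ℂ)) : Prop where
  selfadjoint : IsSelfadjoint B A
  /-- The non-real spectrum in `Ω` has no accumulation point in `Ω`. -/
  no_accPt : ∀ p ∈ Ω, ¬ AccPt p
    (𝓟 ((fun z : ℂ => (z : OnePoint ℂ)) '' spectrum A ∩ (Ω \ Set.range extReal)))
  /-- The non-real spectrum in `Ω` consists of poles of the resolvent. -/
  poles : ∀ z ∈ spectrum A, (z : OnePoint ℂ) ∈ Ω \ Set.range extReal → IsResolventPole A z
  /-- Growth of the resolvent near closed subsets of `Ω ∩ (ℝ ∪ {∞})`. -/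
  growth : ∀ Δ : Set (OnePoint ℂ), IsClosed Δ → Δ ⊆ Ω ∩ Set.range extReal →
    ∃ U : Set (OnePoint ℂ), IsOpen U ∧ Δ ⊆ U ∧ ∃ m : ℕ, 1 ≤ m ∧ ∃ M : ℝ, 0 < M ∧
      ∀ z : ℂ, (z : OnePoint ℂ) ∈ U \ Set.range extReal → z ∈ resolventSet A ∧
        ‖resolvent A z‖ ≤ M * ((1 + ‖z‖) ^ (2 * m - 2) / |z.im| ^ m)
  /-- Each point of `Ω ∩ (ℝ ∪ {∞})` has an open connected neighbourhood `I` in `ℝ ∪ {∞}` such that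
  each component of `I \ {point}` is of definite type. -/
  definite : ∀ p : OnePoint ℝ, extReal p ∈ Ω →
    ∃ I : Set (OnePoint ℝ), IsOpen I ∧ IsConnected I ∧ p ∈ I ∧
      ∀ q ∈ I \ {p}, IsOfDefiniteType B A
        {z : ℂ | ∃ t : ℝ, (t : ℂ) = z ∧ (t : OnePoint ℝ) ∈ connectedComponentIn (I \ {p}) q}

end Krein

end

namespace Krein

open Filter Topology

variable {K : Type*} [NormedAddCommGroup K] [NormedSpace ℂ K]

/-! ### Products and resolvents through graphs -/

/-! Write `S` for the adjoint of `T`. Away from 0 the operators `S T` and `T S` have the same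
spectrum, because formally `(T S - z)⁻¹ = z⁻¹ (T (S T - z)⁻¹ S - 1)`. The right side is only defined
on `dom S`, so it is regularized with one fixed resolvent of each product. This gives a formula in
bounded operators (`swapResolvent`, `ResolventFactors.isResolventAt_swap`). Poles at nonzero points
carry over through it, and so does polynomial growth, at the price of raising `m` by one because of
the factor `1/z`.

If `x n` is an approximate eigensequence of `T S` at a real `t ≠ 0`, then `S x n`, suitably
regularized, is one of `S T` up to normalization, and `[S x, S x] = [T S x, x] ≈ t [x, x]`. Hence
sign types agree for `t > 0` and are exchanged for `t < 0`
(`ResolventFactors.mem_signTypeSpectrum`). Definiteness survives on punctured neighbourhoods shrunk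
so that they avoid 0 and ∞, where `t` changes sign.

Selfadjointness of the other product follows from symmetry and a conjugate pair of resolvent points
(`IsKreinForm.isSelfadjoint`). This rests on the Riesz theorem for Krein spaces and the
nondegeneracy of the form. -/

theorem mem_graph_mul {S T : K →ₗ.[ℂ] K} {x z : K} :
    (x, z) ∈ (mul S T).graph ↔ ∃ y, (x, y) ∈ T.graph ∧ (y, z) ∈ S.graph := by
  simp only [LinearPMap.mem_graph_iff]
  constructor
  · rintro ⟨⟨x', y, hy, rfl⟩, rfl, rfl⟩
    exact ⟨T y, ⟨y, rfl, rfl⟩, ⟨T y, hy⟩, rfl, rfl⟩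
  · rintro ⟨y, ⟨a, rfl, rfl⟩, b, hb, rfl⟩
    have ha : T a ∈ S.domain := hb ▸ b.2
    obtain rfl : b = ⟨T a, ha⟩ := Subtype.ext hb
    exact ⟨⟨a, a, ha, rfl⟩, rfl, rfl⟩

/-- In graph form no elements of domain subtypes occur, and resolvent identities become closure
properties of a subspace of `K × K`. -/
theorem isResolventAt_iff_graph {A : K →ₗ.[ℂ] K} {z : ℂ} {R : K →L[ℂ] K} :
    IsResolventAt A z R ↔ (∀ y, (R y, y + z • R y) ∈ A.graph) ∧
      ∀ x w, (x, w) ∈ A.graph → R (w - z • x) = x := by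
  refine and_congr (forall_congr' fun y => ?_) ?_
  · rw [LinearPMap.mem_graph_iff]
    constructor
    · rintro ⟨h, e⟩
      exact ⟨⟨R y, h⟩, rfl, sub_eq_iff_eq_add.1 e⟩
    · rintro ⟨⟨a, ha⟩, e, e'⟩
      obtain rfl : a = R y := e
      exact ⟨ha, sub_eq_iff_eq_add.2 e'⟩
  · constructor
    · intro h x w hx
      obtain ⟨a, rfl, rfl⟩ := (LinearPMap.mem_graph_iff _).1 hx
      exact h a
    · intro h x
      exact h _ _ (A.mem_graph x)

theorem IsResolventAt.mem_graph {A : K →ₗ.[ℂ] K} {z : ℂ} {R : K →L[ℂ] K}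
    (h : IsResolventAt A z R) (y : K) : (R y, y + z • R y) ∈ A.graph :=
  (isResolventAt_iff_graph.1 h).1 y

theorem IsResolventAt.apply_graph {A : K →ₗ.[ℂ] K} {z : ℂ} {R : K →L[ℂ] K}
    (h : IsResolventAt A z R) {x w : K} (hx : (x, w) ∈ A.graph) : R (w - z • x) = x :=
  (isResolventAt_iff_graph.1 h).2 x w hx

theorem IsResolventAt.resolvent_eq {A : K →ₗ.[ℂ] K} {z : ℂ} {R : K →L[ℂ] K}
    (h : IsResolventAt A z R) : resolvent A z = R := by
  have hex : ∃ R : K →L[ℂ] K, IsResolventAt A z R := ⟨R, h⟩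
  rw [resolvent, dif_pos hex]
  ext y
  have := hex.choose_spec.apply_graph (h.mem_graph y)
  rwa [add_sub_cancel_right] at this

theorem isResolventAt_resolvent {A : K →ₗ.[ℂ] K} {z : ℂ} (h : z ∈ resolventSet A) :
    IsResolventAt A z (resolvent A z) := by
  obtain ⟨R, hR⟩ := h
  rwa [hR.resolvent_eq]

/-- If `T` is closed and the bounded operator `R` has its range in `dom T`, then `T R` is
bounded. -/
theorem exists_clm_graph [CompleteSpace K] {T : K →ₗ.[ℂ] K} (hT : T.IsClosed) (R : K →L[ℂ] K)
    (hR : ∀ y, ∃ w, (R y, w) ∈ T.graph) : ∃ F : K →L[ℂ] K, ∀ y, (R y, F y) ∈ T.graph := by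
  choose f hf using hR
  let g : K →ₗ[ℂ] K :=
    { toFun := f
      map_add' := fun x y => T.mem_graph_snd_inj (hf (x + y))
        (T.graph.add_mem (hf x) (hf y)) (map_add R x y)
      map_smul' := fun c x => T.mem_graph_snd_inj (hf (c • x))
        (T.graph.smul_mem c (hf x)) (map_smul R c x) }
  -- The graph of `T R` is a continuous preimage of the closed graph of `T`, so the closed graph
  -- theorem applies.
  have hg : IsClosed (g.graph : Set (K × K)) := by
    have : (g.graph : Set (K × K)) = (fun p : K × K => (R p.1, p.2)) ⁻¹' T.graph := by
      ext ⟨x, y⟩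
      simp only [SetLike.mem_coe, LinearMap.mem_graph_iff, Set.mem_preimage]
      exact ⟨fun h => h ▸ hf x, fun h => T.mem_graph_snd_inj h (hf x) rfl⟩
    rw [this]
    exact IsClosed.preimage (by fun_prop) hT
  exact ⟨ContinuousLinearMap.ofIsClosedGraph hg, hf⟩

/-! ### The resolvents of `S T` and `T S` -/

/-- Bounded operators `Q = (T S - μ)⁻¹`, `G = S Q` and `F = T (S T - ν)⁻¹`. -/
structure ResolventFactors (T S : K →ₗ.[ℂ] K) (μ ν : ℂ) (Q F G : K →L[ℂ] K) : Prop where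
  isResolventAt : IsResolventAt (mul T S) μ Q
  graph_right : ∀ y, (Q y, G y) ∈ S.graph
  graph_left : ∀ x w, (x, w) ∈ (mul S T).graph → (x, F (w - ν • x)) ∈ T.graph

theorem exists_resolventFactors [CompleteSpace K] {T S : K →ₗ.[ℂ] K} (hT : T.IsClosed)
    (hS : S.IsClosed) (h₁ : (resolventSet (mul S T)).Nonempty)
    (h₂ : (resolventSet (mul T S)).Nonempty) :
    ∃ μ ν Q F G, ResolventFactors T S μ ν Q F G := by
  obtain ⟨ν, R, hR⟩ := h₁
  obtain ⟨μ, Q, hQ⟩ := h₂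
  obtain ⟨F, hF⟩ := exists_clm_graph hT R fun y =>
    (mem_graph_mul.1 (hR.mem_graph y)).imp fun _ h => h.1
  obtain ⟨G, hG⟩ := exists_clm_graph hS Q fun y =>
    (mem_graph_mul.1 (hQ.mem_graph y)).imp fun _ h => h.1
  refine ⟨μ, ν, Q, F, G, hQ, hG, fun x w hx => ?_⟩
  have := hF (w - ν • x)
  rwa [hR.apply_graph hx] at this

/-- The resolvent of `T S` at `z`, expressed through the resolvent `R` of `S T` at `z`. -/
noncomputable def swapResolvent (μ ν : ℂ) (Q F G : K →L[ℂ] K) (z : ℂ) (R : K →L[ℂ] K) :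
    K →L[ℂ] K :=
  (μ / z) • Q + ((z - μ) / z) • (F ∘L (1 + (z - ν) • R) ∘L G)

variable {T S : K →ₗ.[ℂ] K} {μ ν : ℂ} {Q F G : K →L[ℂ] K}

/-- Insert the formal identity `(T S - z)⁻¹ = z⁻¹ (T R S - 1)` into `(T S - z)⁻¹ = Q + (z - μ) (T S
- z)⁻¹ Q`. Then `S` occurs only in `S Q = G`, and `T R = F (1 + (z - ν) R)` is bounded. -/
theorem ResolventFactors.isResolventAt_swap (h : ResolventFactors T S μ ν Q F G) {z : ℂ}
    (hz : z ≠ 0) {R : K →L[ℂ] K} (hR : IsResolventAt (mul S T) z R) :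
    IsResolventAt (mul T S) z (swapResolvent μ ν Q F G z R) := by
  have hTR : ∀ y, (R y, F (y + (z - ν) • R y)) ∈ T.graph := fun y => by
    have := h.graph_left _ _ (hR.mem_graph y)
    rwa [add_sub_assoc, ← sub_smul] at this
  have hST : ∀ y, (F (y + (z - ν) • R y), y + z • R y) ∈ S.graph := fun y => by
    obtain ⟨w, hw, hw'⟩ := mem_graph_mul.1 (hR.mem_graph y)
    rwa [← T.mem_graph_snd_inj (hTR y) hw rfl] at hw'
  have key : ∀ y, (swapResolvent μ ν Q F G z R y, y + z • swapResolvent μ ν Q F G z R y) ∈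
      (mul T S).graph := fun y => by
    obtain ⟨w, hw, hw'⟩ := mem_graph_mul.1 (h.isResolventAt.mem_graph y)
    obtain rfl := S.mem_graph_snd_inj (h.graph_right y) hw rfl
    refine mem_graph_mul.2 ⟨(μ / z) • G y + ((z - μ) / z) • (G y + z • R (G y)), ?_, ?_⟩
    · exact S.graph.add_mem (S.graph.smul_mem (μ / z) (h.graph_right y))
        (S.graph.smul_mem ((z - μ) / z) (hST (G y)))
    · have e₁ : (μ / z) • G y + ((z - μ) / z) • (G y + z • R (G y)) =
          G y + (z - μ) • R (G y) := by
        match_scalars <;> field_simp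
        ring
      have e₂ : y + z • swapResolvent μ ν Q F G z R y =
          (y + μ • Q y) + (z - μ) • F (G y + (z - ν) • R (G y)) := by
        simp only [swapResolvent, add_apply, smul_apply, ContinuousLinearMap.comp_apply,
          one_apply_eq_self]
        match_scalars <;> field_simp
      rw [e₁, e₂]
      exact T.graph.add_mem hw' (T.graph.smul_mem (z - μ) (hTR (G y)))
  -- If `T S x = z x`, then `y = S x` satisfies `S T y = z y`. Hence `y = 0` and `z x = T y = 0`.
  have inj : ∀ x, (x, z • x) ∈ (mul T S).graph → x = 0 := fun x hx => by
    obtain ⟨y, hy, hy'⟩ := mem_graph_mul.1 hx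
    have h₁ : (y, z • y) ∈ (mul S T).graph := mem_graph_mul.2 ⟨_, hy', S.graph.smul_mem z hy⟩
    have h₂ := hR.apply_graph h₁
    rw [sub_self, map_zero] at h₂
    subst h₂
    exact (smul_eq_zero.1 (T.graph_fst_eq_zero_snd hy' rfl)).resolve_left hz
  refine isResolventAt_iff_graph.2 ⟨key, fun x w hx => sub_eq_zero.1 (inj _ ?_)⟩
  have := (mul T S).graph.sub_mem (key (w - z • x)) hx
  convert this using 1
  ext1
  · rfl
  · simp only [Prod.snd_sub]
    module

theorem ResolventFactors.mem_resolventSet (h : ResolventFactors T S μ ν Q F G) {z : ℂ}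
    (hz : z ≠ 0) (hR : z ∈ resolventSet (mul S T)) : z ∈ resolventSet (mul T S) :=
  ⟨_, h.isResolventAt_swap hz (isResolventAt_resolvent hR)⟩

theorem ResolventFactors.resolvent_eq (h : ResolventFactors T S μ ν Q F G) {z : ℂ}
    (hz : z ≠ 0) (hR : z ∈ resolventSet (mul S T)) :
    resolvent (mul T S) z = swapResolvent μ ν Q F G z (resolvent (mul S T) z) :=
  (h.isResolventAt_swap hz (isResolventAt_resolvent hR)).resolvent_eq

/-! ### Growth and poles -/

/-- The bound is uniform in `z ≠ 0`: `‖z - μ‖` and `‖z - ν‖` are at most constants times `1 + ‖z‖`.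
Uniformity is needed because closed subsets of `Ω` may contain 0 or ∞. -/
theorem norm_swapResolvent_le (μ ν : ℂ) (Q F G : K →L[ℂ] K) :
    ∃ c : ℝ, 0 < c ∧ ∀ z : ℂ, z ≠ 0 → ∀ R : K →L[ℂ] K,
      ‖swapResolvent μ ν Q F G z R‖ ≤ c * ((1 + ‖z‖) / ‖z‖ * (1 + (1 + ‖z‖) * ‖R‖)) := by
  refine ⟨‖μ‖ * ‖Q‖ + (1 + ‖μ‖) * (‖F‖ * (1 + (1 + ‖ν‖)) * ‖G‖) + 1, by positivity,
    fun z hz R => ?_⟩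
  have hz' : 0 < ‖z‖ := norm_pos_iff.2 hz
  have h1 : ‖(1 : K →L[ℂ] K)‖ ≤ 1 := ContinuousLinearMap.norm_id_le
  set r := ‖R‖
  have hr : 0 ≤ r := norm_nonneg _
  set s := ‖z‖
  have a1 : ‖z - μ‖ ≤ (1 + ‖μ‖) * (1 + s) := by
    nlinarith [norm_sub_le z μ, norm_nonneg μ]
  have a2 : ‖z - ν‖ ≤ (1 + ‖ν‖) * (1 + s) := by
    nlinarith [norm_sub_le z ν, norm_nonneg ν]
  have a3 : ‖(1 : K →L[ℂ] K) + (z - ν) • R‖ ≤ (1 + (1 + ‖ν‖)) * (1 + (1 + s) * r) := by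
    calc ‖(1 : K →L[ℂ] K) + (z - ν) • R‖ ≤ 1 + (1 + ‖ν‖) * (1 + s) * r := by
          refine (norm_add_le _ _).trans (add_le_add h1 ?_)
          rw [norm_smul]
          gcongr
      _ ≤ _ := by nlinarith [norm_nonneg ν, mul_nonneg (by positivity : 0 ≤ 1 + s) hr]
  have a4 : ‖F ∘L (1 + (z - ν) • R) ∘L G‖ ≤
      ‖F‖ * (1 + (1 + ‖ν‖)) * ‖G‖ * (1 + (1 + s) * r) := by
    calc _ ≤ ‖F‖ * (‖(1 : K →L[ℂ] K) + (z - ν) • R‖ * ‖G‖) :=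
          (ContinuousLinearMap.opNorm_comp_le _ _).trans (by
            gcongr; exact ContinuousLinearMap.opNorm_comp_le _ _)
      _ ≤ ‖F‖ * ((1 + (1 + ‖ν‖)) * (1 + (1 + s) * r) * ‖G‖) := by gcongr
      _ = _ := by ring
  have b : (1 : ℝ) ≤ 1 + (1 + s) * r := by nlinarith [mul_nonneg (by positivity : 0 ≤ 1 + s) hr]
  calc ‖swapResolvent μ ν Q F G z R‖
      ≤ ‖μ‖ / s * ‖Q‖ + (1 + ‖μ‖) * (1 + s) / s *
          (‖F‖ * (1 + (1 + ‖ν‖)) * ‖G‖ * (1 + (1 + s) * r)) := by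
        refine (norm_add_le _ _).trans ?_
        rw [norm_smul, norm_smul, norm_div, norm_div]
        gcongr
    _ ≤ ‖μ‖ * ((1 + s) / s * (1 + (1 + s) * r)) * ‖Q‖ + (1 + ‖μ‖) * (1 + s) / s *
          (‖F‖ * (1 + (1 + ‖ν‖)) * ‖G‖ * (1 + (1 + s) * r)) := by
        rw [div_eq_mul_inv ‖μ‖ s]
        gcongr
        rw [div_eq_mul_inv, mul_assoc]
        have : (1:ℝ) ≤ (1 + s) * (1 + (1 + s) * r) := by nlinarith
        calc s⁻¹ = s⁻¹ * 1 := by ring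
          _ ≤ s⁻¹ * ((1 + s) * (1 + (1 + s) * r)) := by gcongr
          _ = _ := by ring
    _ = (‖μ‖ * ‖Q‖ + (1 + ‖μ‖) * (‖F‖ * (1 + (1 + ‖ν‖)) * ‖G‖)) *
          ((1 + s) / s * (1 + (1 + s) * r)) := by ring
    _ ≤ _ := mul_le_mul_of_nonneg_right (by linarith) (by positivity)

/-- Polynomial growth of the resolvent of `S T` near the real line carries over to `T S`. -/
theorem ResolventFactors.growth (h : ResolventFactors T S μ ν Q F G) {m : ℕ} (hm : 1 ≤ m) {M : ℝ}
    (hM : 0 < M) : ∃ M' : ℝ, 0 < M' ∧ ∀ z : ℂ, z.im ≠ 0 → z ∈ resolventSet (mul S T) →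
      ‖resolvent (mul S T) z‖ ≤ M * ((1 + ‖z‖) ^ (2 * m - 2) / |z.im| ^ m) →
      ‖resolvent (mul T S) z‖ ≤ M' * ((1 + ‖z‖) ^ (2 * (m + 1) - 2) / |z.im| ^ (m + 1)) := by
  obtain ⟨c, hc, H⟩ := norm_swapResolvent_le μ ν Q F G
  refine ⟨c * (1 + M), by positivity, fun z hz hR hle => ?_⟩
  have hz0 : z ≠ 0 := by rintro rfl; exact hz rfl
  rw [h.resolvent_eq hz0 hR]
  refine (H z hz0 _).trans ?_
  rw [mul_assoc]
  refine mul_le_mul_of_nonneg_left ?_ hc.le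
  -- Writing `m = k + 1` removes the truncated subtraction in `2 * m - 2`.
  obtain ⟨k, rfl⟩ : ∃ k, m = k + 1 := ⟨m - 1, by omega⟩
  simp only [show 2 * (k + 1) - 2 = 2 * k by omega,
    show 2 * (k + 1 + 1) - 2 = 2 * k + 2 by omega] at hle ⊢
  have ht : 0 < |z.im| := abs_pos.2 hz
  have hts : |z.im| ≤ ‖z‖ := Complex.abs_im_le_norm z
  set r := ‖resolvent (mul S T) z‖
  set s := ‖z‖
  set t := |z.im|
  have hs : 0 < s := ht.trans_le hts
  have h1 : (1 : ℝ) ≤ (1 + s) ^ (2 * k + 1) / t ^ (k + 1) := by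
    rw [one_le_div (by positivity)]
    calc t ^ (k + 1) ≤ (1 + s) ^ (k + 1) := by gcongr; linarith
      _ ≤ (1 + s) ^ (2 * k + 1) := by gcongr <;> linarith
  -- The estimate `1/s ≤ 1/t` costs one power of `t`; the two additional factors `1 + s` fit exactly
  -- into the exponent for `m + 1`.
  calc (1 + s) / s * (1 + (1 + s) * r)
      ≤ (1 + s) / t * ((1 + s) ^ (2 * k + 1) / t ^ (k + 1) +
          (1 + s) * (M * ((1 + s) ^ (2 * k) / t ^ (k + 1)))) := by gcongr
    _ = _ := by field_simp; ring

theorem meromorphicAt_clm_comp {E E' : Type*} [NormedAddCommGroup E] [NormedSpace ℂ E]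
    [NormedAddCommGroup E'] [NormedSpace ℂ E'] (L : E →L[ℂ] E') {f : ℂ → E} {z : ℂ}
    (hf : MeromorphicAt f z) : MeromorphicAt (fun w => L (f w)) z := by
  obtain ⟨n, hn⟩ := hf
  refine ⟨n, ?_⟩
  have := (L.analyticAt _).comp hn
  simpa [Function.comp_def] using this

/-- `R ↦ F R G` as a bounded operator. -/
noncomputable def sandwich (F G : K →L[ℂ] K) : (K →L[ℂ] K) →L[ℂ] (K →L[ℂ] K) :=
  (ContinuousLinearMap.compL ℂ K K K F) ∘L ((ContinuousLinearMap.compL ℂ K K K).flip G)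

theorem swapResolvent_eq (μ ν : ℂ) (Q F G : K →L[ℂ] K) (z : ℂ) (R : K →L[ℂ] K) :
    swapResolvent μ ν Q F G z R =
      (μ / z) • Q + ((z - μ) / z) • sandwich F G (1 + (z - ν) • R) := rfl

theorem meromorphicAt_swapResolvent (μ ν : ℂ) (Q F G : K →L[ℂ] K) {z : ℂ} {R : ℂ → K →L[ℂ] K}
    (hR : MeromorphicAt R z) : MeromorphicAt (fun w => swapResolvent μ ν Q F G w (R w)) z := by
  simp only [swapResolvent_eq]
  have hid : MeromorphicAt (fun w : ℂ => w) z := MeromorphicAt.id z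
  have hc : ∀ a : ℂ, MeromorphicAt (fun _ : ℂ => a) z := fun a => MeromorphicAt.const a z
  exact (((hc μ).div hid).smul (MeromorphicAt.const Q z)).add
    (((hid.sub (hc μ)).div hid).smul (meromorphicAt_clm_comp _
      ((MeromorphicAt.const 1 z).add ((hid.sub (hc ν)).smul hR))))

theorem tendsto_swapResolvent (μ ν : ℂ) (Q F G : K →L[ℂ] K) {z : ℂ} (hz : z ≠ 0)
    {R : ℂ → K →L[ℂ] K} {L : K →L[ℂ] K} (hR : Tendsto R (𝓝[≠] z) (𝓝 L)) :
    Tendsto (fun w => swapResolvent μ ν Q F G w (R w)) (𝓝[≠] z)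
      (𝓝 (swapResolvent μ ν Q F G z L)) := by
  simp only [swapResolvent_eq]
  have hid : Tendsto (fun w : ℂ => w) (𝓝[≠] z) (𝓝 z) := tendsto_id.mono_left nhdsWithin_le_nhds
  exact (((tendsto_const_nhds).div hid hz).smul tendsto_const_nhds).add
    (((hid.sub tendsto_const_nhds).div hid hz).smul (((sandwich F G).continuous.tendsto _).comp
      (tendsto_const_nhds.add ((hid.sub tendsto_const_nhds).smul hR))))

/-- Nonzero poles of the resolvent of `S T` are poles of the resolvent of `T S`. -/
theorem ResolventFactors.isResolventPole (h : ResolventFactors T S μ ν Q F G)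
    {μ' ν' : ℂ} {Q' F' G' : K →L[ℂ] K} (h' : ResolventFactors S T μ' ν' Q' F' G') {z : ℂ}
    (hz : z ≠ 0) (hp : IsResolventPole (mul S T) z) : IsResolventPole (mul T S) z := by
  obtain ⟨hσ, hev, hmer, hord⟩ := hp
  have hne : ∀ᶠ w in 𝓝[≠] z, w ≠ 0 := nhdsWithin_le_nhds (isOpen_ne.mem_nhds hz)
  have hev' : ∀ᶠ w in 𝓝[≠] z, w ∈ resolventSet (mul T S) := by
    filter_upwards [hev, hne] with w hw hw0 using h.mem_resolventSet hw0 hw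
  have hmer' : MeromorphicAt (resolvent (mul T S)) z := by
    refine (meromorphicAt_swapResolvent μ ν Q F G hmer).congr ?_
    filter_upwards [hev, hne] with w hw hw0 using (h.resolvent_eq hw0 hw).symm
  refine ⟨fun hC => hσ (h'.mem_resolventSet hz hC), hev', hmer', ?_⟩
  -- Without a pole the resolvent of `T S` would have a limit at `z`, and the formula with the roles
  -- exchanged would give one for `S T`.
  by_contra hcon
  obtain ⟨L, hL⟩ := (tendsto_nhds_iff_meromorphicOrderAt_nonneg hmer').2 (not_lt.1 hcon)
  refine hord.not_ge ((tendsto_nhds_iff_meromorphicOrderAt_nonneg hmer).1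
    ⟨_, (tendsto_swapResolvent μ' ν' Q' F' G' hz hL).congr' ?_⟩)
  filter_upwards [hev', hne] with w hw hw0 using (h'.resolvent_eq hw0 hw).symm

end Krein

namespace Krein

open Filter Topology

variable {K : Type*} [NormedAddCommGroup K] [NormedSpace ℂ K]

/-! ### Transfer of the sign type -/

/-- `[T x, y] = [x, S y]` on the domains of `T` and `S`. -/
def IsFormalAdjoint (B : K →ₗ⋆[ℂ] K →ₗ[ℂ] ℂ) (T S : K →ₗ.[ℂ] K) : Prop :=
  ∀ ⦃x u y v : K⦄, (x, u) ∈ T.graph → (y, v) ∈ S.graph → B u y = B x v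

variable {B : K →ₗ⋆[ℂ] K →ₗ[ℂ] ℂ} {T S : K →ₗ.[ℂ] K}

theorem IsFormalAdjoint.symm (hB : IsKreinForm B) (h : IsFormalAdjoint B T S) :
    IsFormalAdjoint B S T := fun x u y v hx hy => by
  rw [hB.hermitian y u, hB.hermitian v x, h hy hx]

/-- Continuity at the origin bounds the form on a small ball; scaling extends the bound to all
vectors. -/
theorem IsKreinForm.exists_bound (hB : IsKreinForm B) :
    ∃ c : ℝ, 0 < c ∧ ∀ x y, ‖B x y‖ ≤ c * ‖x‖ * ‖y‖ := by
  have h0 : Tendsto (fun p : K × K => B p.1 p.2) (𝓝 0) (𝓝 0) := by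
    simpa using hB.continuous.tendsto 0
  obtain ⟨δ, hδ, H⟩ := Metric.mem_nhds_iff.1 (h0 (Metric.ball_mem_nhds 0 one_pos))
  have key : ∀ x y, ‖x‖ < δ → ‖y‖ < δ → ‖B x y‖ ≤ 1 := fun x y hx hy => by
    have : (x, y) ∈ Metric.ball (0 : K × K) δ := by
      rw [mem_ball_zero_iff, Prod.norm_def]
      exact max_lt hx hy
    simpa using (mem_ball_zero_iff.1 (H this)).le
  refine ⟨(4 / (δ * δ)), by positivity, fun x y => ?_⟩
  rcases eq_or_ne x 0 with rfl | hx
  · simp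
  rcases eq_or_ne y 0 with rfl | hy
  · simp
  have hx' := norm_pos_iff.2 hx
  have hy' := norm_pos_iff.2 hy
  have hn : ∀ w : K, w ≠ 0 → ‖((δ / 2 / ‖w‖ : ℝ) : ℂ) • w‖ < δ := fun w hw => by
    have := norm_pos_iff.2 hw
    rw [norm_smul, Complex.norm_real, Real.norm_of_nonneg (by positivity),
      div_mul_cancel₀ _ this.ne']
    linarith
  have := key _ _ (hn x hx) (hn y hy)
  rw [map_smul, map_smulₛₗ, LinearMap.smul_apply, norm_smul, norm_smul, RCLike.norm_conj,
    Complex.norm_real, Complex.norm_real, Real.norm_of_nonneg (by positivity),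
    Real.norm_of_nonneg (by positivity)] at this
  calc ‖B x y‖ = (4 / (δ * δ)) * ‖x‖ * ‖y‖ * (δ / 2 / ‖y‖ * (δ / 2 / ‖x‖ * ‖B x y‖)) := by
        field_simp; norm_num
    _ ≤ (4 / (δ * δ)) * ‖x‖ * ‖y‖ * 1 := by gcongr
    _ = _ := mul_one _

/-- The form is asymptotically unchanged under null perturbations of bounded sequences. -/
theorem IsKreinForm.tendsto_sub (hB : IsKreinForm B) {a a' b b' : ℕ → K} {r : ℝ}
    (ha : ∀ n, ‖a n‖ ≤ r) (hb : ∀ n, ‖b n‖ ≤ r) (haa : Tendsto (fun n => a' n - a n) atTop (𝓝 0))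
    (hbb : Tendsto (fun n => b' n - b n) atTop (𝓝 0)) :
    Tendsto (fun n => B (a' n) (b' n) - B (a n) (b n)) atTop (𝓝 0) := by
  obtain ⟨c, hc, H⟩ := hB.exists_bound
  have haa' := tendsto_zero_iff_norm_tendsto_zero.1 haa
  have hbb' := tendsto_zero_iff_norm_tendsto_zero.1 hbb
  have hlim : Tendsto (fun n => c * ‖a' n - a n‖ * ‖b' n - b n‖ + c * ‖a' n - a n‖ * r +
      c * r * ‖b' n - b n‖) atTop (𝓝 0) := by
    have := (((haa'.const_mul c).mul hbb').add ((haa'.const_mul c).mul_const r)).add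
      (hbb'.const_mul (c * r))
    simpa using this
  refine squeeze_zero_norm (fun n => ?_) hlim
  have e : B (a' n) (b' n) - B (a n) (b n) = B (a' n - a n) (b' n - b n) + B (a' n - a n) (b n) +
      B (a n) (b' n - b n) := by
    simp only [map_sub, LinearMap.sub_apply]; ring
  rw [e]
  refine (norm_add₃_le).trans (add_le_add_three (H _ _) ((H _ _).trans ?_) ((H _ _).trans ?_))
  · gcongr; exact hb n
  · gcongr; exact ha n

variable {μ ν : ℂ} {Q F G : K →L[ℂ] K}

/-- Approximate eigensequences of `T S` are mapped by (a regularization of) `S` to approximate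
eigensequences of `S T`, up to normalization, and the form is multiplied by the spectral
parameter asymptotically. -/
theorem ResolventFactors.exists_approx (h : ResolventFactors T S μ ν Q F G) (hB : IsKreinForm B)
    (hTS : IsFormalAdjoint B T S) {t : ℝ} (ht : t ≠ 0) {x : ℕ → (mul T S).domain}
    (hx : IsApproxEigenseq (mul T S) t x) :
    ∃ y v : ℕ → K, (∀ n, (y n, v n) ∈ (mul S T).graph) ∧
      Tendsto (fun n => v n - (t : ℂ) • y n) atTop (𝓝 0) ∧
      (∃ δ > 0, ∀ᶠ n in atTop, δ ≤ ‖y n‖) ∧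
      Tendsto (fun n => (B (y n) (y n)).re - t * (B (x n : K) (x n : K)).re) atTop (𝓝 0) := by
  obtain ⟨hx1, hd⟩ := hx
  set d : ℕ → K := fun n => mul T S (x n) - (t : ℂ) • (x n : K) with hd_def
  have hz : (t : ℂ) ≠ 0 := by exact_mod_cast ht
  set z : ℂ := (t : ℂ) with hz_def
  have clm0 : ∀ L : K →L[ℂ] K, Tendsto (fun n => L (d n)) atTop (𝓝 0) := fun L => by
    have := (L.continuous.tendsto 0).comp hd
    rwa [map_zero] at this
  have hQ : ∀ n, Q (d n) + (z - μ) • Q (x n) = x n := fun n => by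
    have := h.isResolventAt.apply_graph ((mul T S).mem_graph (x n))
    rw [← map_smul, ← map_add, ← this]
    congr 1
    rw [this]
    simp only [hd_def]
    module
  have hTG : ∀ n, (G (x n), x n + μ • Q (x n)) ∈ T.graph := fun n => by
    obtain ⟨w, hw, hw'⟩ := mem_graph_mul.1 (h.isResolventAt.mem_graph (x n))
    rwa [← S.mem_graph_snd_inj (h.graph_right (x n)) hw rfl] at hw'
  -- Replacing `x n` by `x' n = x n - Q (d n)` makes `T S x' n = s n` a combination of vectors in
  -- `ran Q ⊆ dom S`. So `y n = S x' n` lies in the domain of `S T`, which `S x n` itself need not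
  -- do.
  let x' : ℕ → K := fun n => (z - μ) • Q (x n)
  let y : ℕ → K := fun n => (z - μ) • G (x n)
  let s : ℕ → K := fun n => z • x' n + (z - μ) • Q (d n)
  let v : ℕ → K := fun n => z • y n + (z - μ) • G (d n)
  have hx' : ∀ n, x' n = x n - Q (d n) := fun n => eq_sub_of_add_eq' (hQ n)
  have hS : ∀ n, (x' n, y n) ∈ S.graph := fun n => S.graph.smul_mem _ (h.graph_right (x n))
  have hT : ∀ n, (y n, s n) ∈ T.graph := fun n => by
    have := T.graph.smul_mem (z - μ) (hTG n)
    have e : s n = (z - μ) • ((x n : K) + μ • Q (x n)) := by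
      have hx'' := hx' n
      simp only [x'] at hx''
      simp only [s, x']
      rw [eq_sub_iff_add_eq, add_comm, ← eq_sub_iff_add_eq] at hx''
      rw [hx'']
      module
    rw [e]
    exact this
  have hv : ∀ n, (y n, v n) ∈ (mul S T).graph := fun n => mem_graph_mul.2 ⟨s n, hT n,
    S.graph.add_mem (S.graph.smul_mem z (hS n)) (S.graph.smul_mem (z - μ) (h.graph_right (d n)))⟩
  have hvy : ∀ n, v n - z • y n = (z - μ) • G (d n) := fun n => add_sub_cancel_left _ _
  have hv0 : Tendsto (fun n => v n - z • y n) atTop (𝓝 0) := by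
    simp only [hvy]
    simpa using (clm0 G).const_smul (z - μ)
  have hs0 : Tendsto (fun n => s n - z • (x n : K)) atTop (𝓝 0) := by
    have : ∀ n, s n - z • (x n : K) = -(μ • Q (d n)) := fun n => by
      simp only [s]; rw [hx' n]; module
    simp only [this]
    simpa using ((clm0 Q).const_smul μ).neg
  have hx0 : Tendsto (fun n => x' n - (x n : K)) atTop (𝓝 0) := by
    have : ∀ n, x' n - (x n : K) = -(Q (d n)) := fun n => by rw [hx' n]; module
    simp only [this]
    simpa using (clm0 Q).neg
  refine ⟨y, v, hv, hv0, ?_, ?_⟩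
  -- Since `F (v n - ν y n) = s n`, the vectors `F ((z - ν) y n)` approach `z x n`, of norm `‖z‖ >
  -- 0`. As `F` is bounded, `y n` cannot become small.
  · have e0 : Tendsto (fun n => F (v n - z • y n) - (s n - z • (x n : K))) atTop (𝓝 0) := by
      have := ((F.continuous.tendsto 0).comp hv0).sub hs0
      simpa using this
    have hFs : ∀ n, F (v n - ν • y n) = s n := fun n =>
      T.mem_graph_snd_inj (h.graph_left _ _ (hv n)) (hT n) rfl
    have e1 : ∀ n, z • (x n : K) =
        (F (v n - z • y n) - (s n - z • (x n : K))) + F ((z - ν) • y n) := fun n => by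
      have : F (v n - z • y n) + F ((z - ν) • y n) = s n := by
        rw [← map_add, ← hFs n]; congr 1; module
      rw [← this]; module
    have hz0 : 0 < ‖z‖ := norm_pos_iff.2 hz
    set c : ℝ := ‖F‖ * ‖z - ν‖ + 1 with hc
    have hcpos : 0 < c := by positivity
    refine ⟨‖z‖ / 2 / c, by positivity, ?_⟩
    filter_upwards [(tendsto_zero_iff_norm_tendsto_zero.1 e0).eventually
      (gt_mem_nhds (half_pos hz0))] with n hn
    rw [div_le_iff₀ hcpos]
    have b1 : ‖z‖ = ‖z • (x n : K)‖ := by rw [norm_smul, hx1 n, mul_one]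
    have b2 : ‖F ((z - ν) • y n)‖ ≤ ‖F‖ * ‖z - ν‖ * ‖y n‖ := by
      refine (F.le_opNorm _).trans_eq ?_
      rw [norm_smul, mul_assoc]
    have b3 := norm_add_le (F (v n - z • y n) - (s n - z • (x n : K))) (F ((z - ν) • y n))
    rw [← e1 n, ← b1] at b3
    have : ‖y n‖ * c = ‖F‖ * ‖z - ν‖ * ‖y n‖ + ‖y n‖ := by rw [hc]; ring
    linarith [norm_nonneg (y n)]
  -- Here `[y n, y n] = [s n, x' n]`, with `s n ≈ z x n` and `x' n ≈ x n`; `z = t` is real.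
  · have H := hB.tendsto_sub (r := 1 + ‖z‖) (a := fun n => z • (x n : K)) (b := fun n => (x n : K))
      (fun n => by simp [norm_smul, hx1 n]) (fun n => by simp [hx1 n]) hs0 hx0
    have := (Complex.continuous_re.tendsto 0).comp H
    rw [Complex.zero_re] at this
    refine this.congr fun n => ?_
    simp only [Function.comp_apply]
    rw [hTS (hT n) (hS n), map_smulₛₗ B z, hz_def, Complex.conj_ofReal, LinearMap.smul_apply,
      smul_eq_mul, Complex.sub_re, Complex.re_ofReal_mul]

/-- The lower bound `δ` keeps the residuals null after normalization; the shift by `N` drops the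
initial terms, which may vanish. -/
theorem exists_isApproxEigenseq {A : K →ₗ.[ℂ] K} {z : ℂ} {y v : ℕ → K}
    (hy : ∀ n, (y n, v n) ∈ A.graph) (hv : Tendsto (fun n => v n - z • y n) atTop (𝓝 0)) {δ : ℝ}
    (hδ : 0 < δ) (hlow : ∀ᶠ n in atTop, δ ≤ ‖y n‖) :
    ∃ N, ∃ x : ℕ → A.domain, IsApproxEigenseq A z x ∧ ∀ n, δ ≤ ‖y (n + N)‖ ∧
      (x n : K) = ((‖y (n + N)‖⁻¹ : ℝ) : ℂ) • y (n + N) := by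
  obtain ⟨N, hN⟩ := eventually_atTop.1 hlow
  have hN' : ∀ n, δ ≤ ‖y (n + N)‖ := fun n => hN _ (Nat.le_add_left N n)
  have hg : ∀ n, (((‖y (n + N)‖⁻¹ : ℝ) : ℂ) • y (n + N), ((‖y (n + N)‖⁻¹ : ℝ) : ℂ) • v (n + N)) ∈
      A.graph := fun n => A.graph.smul_mem _ (hy (n + N))
  have hdom : ∀ n, ((‖y (n + N)‖⁻¹ : ℝ) : ℂ) • y (n + N) ∈ A.domain := fun n =>
    LinearPMap.mem_domain_of_mem_graph (hg n)
  refine ⟨N, fun n => ⟨_, hdom n⟩, ⟨fun n => ?_, ?_⟩, fun n => ⟨hN' n, rfl⟩⟩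
  · have : 0 < ‖y (n + N)‖ := hδ.trans_le (hN' n)
    simp [norm_smul, this.ne']
  · have hA : ∀ n, A ⟨_, hdom n⟩ - z • ((‖y (n + N)‖⁻¹ : ℝ) : ℂ) • y (n + N) =
        ((‖y (n + N)‖⁻¹ : ℝ) : ℂ) • (v (n + N) - z • y (n + N)) := fun n => by
      rw [A.mem_graph_snd_inj (A.mem_graph ⟨_, hdom n⟩) (hg n) rfl]
      module
    refine Tendsto.congr (fun n => (hA n).symm) ?_
    have h0 := tendsto_zero_iff_norm_tendsto_zero.1 (hv.comp (tendsto_add_atTop_nat N))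
    refine squeeze_zero_norm (fun n => ?_) (by simpa using h0.const_mul δ⁻¹)
    rw [norm_smul, Complex.norm_real, norm_inv, norm_norm]
    have := hN' n
    gcongr

/-- The spectral points `z` of `A` in the approximate point spectrum such that `ε [x_n, x_n]` is
eventually bounded below by a positive constant along every approximate eigensequence. For
`ε > 0` these are the points of positive type, for `ε < 0` those of negative type. -/
def signTypeSpectrum (B : K →ₗ⋆[ℂ] K →ₗ[ℂ] ℂ) (ε : ℝ) (A : K →ₗ.[ℂ] K) : Set ℂ :=
  {z | z ∈ spectrum A ∧ z ∈ approxPointSpectrum A ∧ ∀ x, IsApproxEigenseq A z x →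
    ∃ c > 0, ∀ᶠ n in atTop, c ≤ ε * (B (x n : K) (x n : K)).re}

/-- Boundedness matters: the real-valued `liminf` of an unbounded sequence may be a default value.
-/
theorem lt_liminf_iff_of_bounded {u : ℕ → ℝ} {r : ℝ} (hu : ∀ n, |u n| ≤ r) :
    0 < liminf u atTop ↔ ∃ c > 0, ∀ᶠ n in atTop, c ≤ u n := by
  have hb : IsBoundedUnder (· ≥ ·) atTop u := isBoundedUnder_of ⟨-r, fun n => (abs_le.1 (hu n)).1⟩
  have hc : IsBoundedUnder (· ≤ ·) atTop u := isBoundedUnder_of ⟨r, fun n => (abs_le.1 (hu n)).2⟩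
  constructor
  · intro h
    obtain ⟨c, hc0, hc1⟩ := exists_between h
    exact ⟨c, hc0, (eventually_lt_of_lt_liminf hc1 hb).mono fun n hn => hn.le⟩
  · rintro ⟨c, hc0, hev⟩
    exact hc0.trans_le (le_liminf_of_le hc.isCoboundedUnder_ge hev)

theorem limsup_lt_iff_of_bounded {u : ℕ → ℝ} {r : ℝ} (hu : ∀ n, |u n| ≤ r) :
    limsup u atTop < 0 ↔ ∃ c > 0, ∀ᶠ n in atTop, c ≤ -u n := by
  have hb : IsBoundedUnder (· ≥ ·) atTop u := isBoundedUnder_of ⟨-r, fun n => (abs_le.1 (hu n)).1⟩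
  have hc : IsBoundedUnder (· ≤ ·) atTop u := isBoundedUnder_of ⟨r, fun n => (abs_le.1 (hu n)).2⟩
  constructor
  · intro h
    obtain ⟨c, hc0, hc1⟩ := exists_between h
    exact ⟨-c, neg_pos.2 hc1, (eventually_lt_of_limsup_lt hc0 hc).mono fun n hn =>
      neg_le_neg hn.le⟩
  · rintro ⟨c, hc0, hev⟩
    exact (limsup_le_of_le hb.isCoboundedUnder_le (hev.mono fun n hn => le_neg.1 hn)).trans_lt
      (neg_neg_of_pos hc0)

theorem IsKreinForm.exists_bound_approxEigenseq (hB : IsKreinForm B) {A : K →ₗ.[ℂ] K} {z : ℂ}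
    {x : ℕ → A.domain} (hx : IsApproxEigenseq A z x) :
    ∃ r, ∀ n, |(B (x n : K) (x n : K)).re| ≤ r := by
  obtain ⟨c, -, hc⟩ := hB.exists_bound
  refine ⟨c, fun n => (Complex.abs_re_le_norm _).trans ?_⟩
  simpa [hx.1 n] using hc (x n) (x n)

/-- Only the sign of the weight matters, so `ε * t` may serve as a weight in place of `±1`. -/
theorem exists_eventually_le_mul {ε ε' : ℝ} (h : 0 < ε * ε') {u : ℕ → ℝ} :
    (∃ c > 0, ∀ᶠ n in atTop, c ≤ ε * u n) → ∃ c > 0, ∀ᶠ n in atTop, c ≤ ε' * u n := by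
  rintro ⟨c, hc, hev⟩
  have hε : ε ≠ 0 := by rintro rfl; simp at h
  have hq : 0 < ε' / ε := by
    rw [show ε' / ε = ε * ε' / (ε * ε) by field_simp]
    exact div_pos h (mul_self_pos.2 hε)
  refine ⟨ε' / ε * c, mul_pos hq hc, hev.mono fun n hn => ?_⟩
  calc ε' / ε * c ≤ ε' / ε * (ε * u n) := by gcongr
    _ = ε' * u n := by field_simp

theorem posTypeSpectrum_eq (hB : IsKreinForm B) {ε : ℝ} (hε : 0 < ε) (A : K →ₗ.[ℂ] K) :
    posTypeSpectrum B A = signTypeSpectrum B ε A := by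
  ext z
  refine and_congr_right fun _ => and_congr_right fun _ => forall₂_congr fun x hx => ?_
  obtain ⟨r, hr⟩ := hB.exists_bound_approxEigenseq hx
  rw [lt_liminf_iff_of_bounded hr]
  constructor
  · intro h
    exact exists_eventually_le_mul (ε := 1) (by simpa using hε) (by simpa using h)
  · intro h
    simpa using exists_eventually_le_mul (ε' := 1) (by simpa using hε) h

theorem negTypeSpectrum_eq (hB : IsKreinForm B) {ε : ℝ} (hε : ε < 0) (A : K →ₗ.[ℂ] K) :
    negTypeSpectrum B A = signTypeSpectrum B ε A := by
  ext z
  refine and_congr_right fun _ => and_congr_right fun _ => forall₂_congr fun x hx => ?_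
  obtain ⟨r, hr⟩ := hB.exists_bound_approxEigenseq hx
  rw [limsup_lt_iff_of_bounded hr]
  constructor
  · intro h
    exact exists_eventually_le_mul (ε := -1) (by simpa using hε) (by simpa using h)
  · intro h
    simpa using exists_eventually_le_mul (ε' := -1) (by simpa using hε) h

/-- At a real point `t ≠ 0` the sign type of `T S` is that of `S T` times the sign of `t`. -/
theorem ResolventFactors.mem_signTypeSpectrum (h : ResolventFactors T S μ ν Q F G)
    {μ' ν' : ℂ} {Q' F' G' : K →L[ℂ] K} (h' : ResolventFactors S T μ' ν' Q' F' G')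
    (hB : IsKreinForm B) (hTS : IsFormalAdjoint B T S) {ε t : ℝ} (ht : t ≠ 0)
    (hz : (t : ℂ) ∈ signTypeSpectrum B ε (mul S T)) :
    (t : ℂ) ∈ signTypeSpectrum B (ε * t) (mul T S) := by
  obtain ⟨hσ, ⟨x₀, hx₀⟩, hsign⟩ := hz
  refine ⟨fun hC => hσ (h'.mem_resolventSet (by exact_mod_cast ht) hC), ?_, fun x hx => ?_⟩
  · obtain ⟨y, v, hy, hv, ⟨δ, hδ, hlow⟩, -⟩ := h'.exists_approx hB (hTS.symm hB) ht hx₀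
    obtain ⟨N, x, hx, -⟩ := exists_isApproxEigenseq hy hv hδ hlow
    exact ⟨x, hx⟩
  · obtain ⟨y, v, hy, hv, ⟨δ, hδ, hlow⟩, hlim⟩ := h.exists_approx hB hTS ht hx
    obtain ⟨N, x', hx', hxy⟩ := exists_isApproxEigenseq hy hv hδ hlow
    obtain ⟨c, hc, hev⟩ := hsign x' hx'
    have hε0 : Tendsto (fun n => ε * ((B (y n) (y n)).re - t * (B (x n : K) (x n : K)).re)) atTop
        (𝓝 0) := by simpa using hlim.const_mul ε
    have hpos : 0 < c * δ ^ 2 / 2 := by positivity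
    -- Undoing the normalization multiplies the form by `‖y‖ ^ 2 ≥ δ ^ 2`. Half of the resulting
    -- constant then absorbs the null sequence `hε0`.
    have hev' : ∀ᶠ n in atTop, c * δ ^ 2 ≤ ε * (B (y n) (y n)).re := by
      rw [← map_add_atTop_eq_nat N, eventually_map]
      filter_upwards [hev] with n hn
      obtain ⟨h1, h2⟩ := hxy n
      have h0 : 0 < ‖y (n + N)‖ := hδ.trans_le h1
      rw [h2, map_smul, map_smulₛₗ, Complex.conj_ofReal, LinearMap.smul_apply, smul_eq_mul,
        smul_eq_mul, Complex.re_ofReal_mul, Complex.re_ofReal_mul] at hn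
      calc c * δ ^ 2 ≤ c * ‖y (n + N)‖ ^ 2 := by gcongr
        _ ≤ ε * (‖y (n + N)‖⁻¹ * (‖y (n + N)‖⁻¹ * (B (y (n + N)) (y (n + N))).re)) *
            ‖y (n + N)‖ ^ 2 := by gcongr
        _ = _ := by field_simp
    refine ⟨_, hpos, ?_⟩
    filter_upwards [hev', hε0.eventually (gt_mem_nhds hpos)] with n h1 h2
    nlinarith

end Krein

namespace Krein

open Filter Topology

/-! ### The Riesz representation theorem in Krein spaces -/

/-- A copy of `E`, to be normed by a positive definite form. -/
def FormSpace (E : Type*) : Type _ := E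

instance {E : Type*} [AddCommGroup E] : AddCommGroup (FormSpace E) := inferInstanceAs (AddCommGroup E)

instance {E : Type*} [AddCommGroup E] [Module ℂ E] : Module ℂ (FormSpace E) :=
  inferInstanceAs (Module ℂ E)

/-- If a continuous form turns the Banach space `E` into a Hilbert space, then all continuous
functionals on `E` are represented by the form. -/
theorem exists_repr_of_hilbert_form {E : Type*} [NormedAddCommGroup E] [NormedSpace ℂ E]
    [CompleteSpace E] (b : E →ₗ⋆[ℂ] E →ₗ[ℂ] ℂ)
    (herm : ∀ x y, b y x = (starRingEnd ℂ) (b x y)) {c : ℝ} (hc : 0 < c)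
    (hbound : ∀ x, ‖b x x‖ ≤ c * ‖x‖ * ‖x‖) (hpos : ∀ x, x ≠ 0 → 0 < (b x x).re)
    (hcomplete : ∀ u : ℕ → E,
      (∀ ε > 0, ∃ N, ∀ m ≥ N, ∀ n ≥ N, (b (u m - u n) (u m - u n)).re < ε) →
      ∃ x, Tendsto (fun n => (b (u n - x) (u n - x)).re) atTop (𝓝 0))
    (f : E →L[ℂ] ℂ) : ∃ y, ∀ x, f x = b y x := by
  have hnonneg : ∀ x, 0 ≤ (b x x).re := fun x => by
    rcases eq_or_ne x 0 with rfl | h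
    · simp
    · exact (hpos x h).le
  have hdef : ∀ x, b x x = 0 → x = 0 := fun x hx => by
    by_contra h
    simpa [hx] using hpos x h
  let core : InnerProductSpace.Core ℂ (FormSpace E) :=
    { inner := fun x y => b x y
      conj_inner_symm := fun x y => (herm y x).symm
      re_inner_nonneg := hnonneg
      add_left := fun x y z => b.map_add₂ x y z
      smul_left := fun x y r => b.map_smulₛₗ₂ r x y
      definite := hdef }
  let _ : NormedAddCommGroup (FormSpace E) := core.toNormedAddCommGroup
  let _ : InnerProductSpace ℂ (FormSpace E) := InnerProductSpace.ofCore core.toCore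
  have hnorm : ∀ x : FormSpace E, ‖x‖ ^ 2 = (b x x).re := fun x =>
    (inner_self_eq_norm_sq (𝕜 := ℂ) x).symm
  have : CompleteSpace (FormSpace E) := by
    refine Metric.complete_of_cauchySeq_tendsto fun u hu => ?_
    obtain ⟨x, hx⟩ := hcomplete u fun ε hε => by
      obtain ⟨N, hN⟩ := Metric.cauchySeq_iff.1 hu (√ε) (Real.sqrt_pos.2 hε)
      refine ⟨N, fun m hm n hn => ?_⟩
      have := hN m hm n hn
      rw [dist_eq_norm, Real.lt_sqrt (norm_nonneg _), hnorm] at this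
      exact this
    let x' : FormSpace E := x
    refine ⟨x', tendsto_iff_norm_sub_tendsto_zero.2 ?_⟩
    have h2 : Tendsto (fun n => ‖u n - x'‖ ^ 2) atTop (𝓝 0) := by
      simp only [hnorm]; exact hx
    have h3 := h2.sqrt
    simp only [Real.sqrt_zero, Real.sqrt_sq (norm_nonneg _)] at h3
    exact h3
  let i : E →ₗ[ℂ] FormSpace E :=
    { toFun := fun x => x
      map_add' := fun _ _ => rfl
      map_smul' := fun _ _ => rfl }
  have hi : ∀ x, ‖i x‖ ≤ √c * ‖x‖ := fun x => by
    refine abs_le_of_sq_le_sq' ?_ (by positivity) |>.2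
    rw [hnorm, mul_pow, Real.sq_sqrt hc.le]
    calc (b x x).re ≤ ‖b x x‖ := Complex.re_le_norm _
      _ ≤ _ := (hbound x).trans_eq (by ring)
  let j : E →L[ℂ] FormSpace E := i.mkContinuous _ hi
  -- By the open mapping theorem the two complete norms are equivalent, so `f` is continuous for the
  -- form norm too.
  let e : E ≃L[ℂ] FormSpace E := ContinuousLinearEquiv.ofBijective j
    (LinearMap.ker_eq_bot.2 fun x y h => h) (LinearMap.range_eq_top.2 fun x => ⟨x, rfl⟩)
  let y := (InnerProductSpace.toDual ℂ (FormSpace E)).symm (f ∘L (e.symm : FormSpace E →L[ℂ] E))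
  refine ⟨y, fun x => ?_⟩
  have h1 : inner ℂ y (e x) = f x := by
    rw [InnerProductSpace.toDual_symm_apply]
    simp
  exact h1.symm

variable {K : Type*} [NormedAddCommGroup K] [NormedSpace ℂ K]
variable {B : K →ₗ⋆[ℂ] K →ₗ[ℂ] ℂ}

theorem IsKreinForm.exists_repr_on_hilbertSubspace [CompleteSpace K] (hB : IsKreinForm B)
    {P N : Submodule ℂ K} (hPN : IsCompl P N) (horth : ∀ x ∈ P, ∀ y ∈ N, B x y = 0)
    (hP : IsHilbertSubspace B P) (hN : IsHilbertSubspace (-B) N) (f : K →L[ℂ] ℂ) :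
    ∃ p ∈ P, ∀ x ∈ P, f x = B p x := by
  -- `P` is the orthogonal complement of `N`: if `p + n` is orthogonal to `n`, then `[n, n] = 0`, so
  -- `n = 0` by definiteness on `N`.
  have hclosed : IsClosed (P : Set K) := by
    have : (P : Set K) = ⋂ y ∈ N, {x | B x y = 0} := by
      ext x
      simp only [SetLike.mem_coe, Set.mem_iInter, Set.mem_ofPred_eq]
      refine ⟨fun hx y hy => horth x hx y hy, fun h => ?_⟩
      obtain ⟨p, hp, n, hn, rfl⟩ := Submodule.mem_sup.1
        (hPN.sup_eq_top ▸ Submodule.mem_top : x ∈ P ⊔ N)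
      have h0 := h n hn
      rw [map_add, LinearMap.add_apply, horth p hp n hn, zero_add] at h0
      by_cases hn0 : n = 0
      · simpa [hn0] using hp
      · have := hN.pos n hn hn0
        simp [h0] at this
    rw [this]
    refine isClosed_biInter fun y _ => isClosed_eq ?_ continuous_const
    exact hB.continuous.comp (Continuous.prodMk_left y)
  have : CompleteSpace P := hclosed.completeSpace_coe
  obtain ⟨c, hc, hbound⟩ := hB.exists_bound
  obtain ⟨y, hy⟩ := exists_repr_of_hilbert_form (E := P) (B.domRestrict₁₂ P P)
    (fun x y => hB.hermitian x y) hc (fun x => hbound x x)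
    (fun x hx => hP.pos x x.2 fun h => hx (Subtype.ext h))
    (fun u hu => by
      obtain ⟨x, hx, h⟩ := hP.complete (fun n => u n) (fun n => (u n).2) hu
      exact ⟨⟨x, hx⟩, h⟩) (f ∘L P.subtypeL)
  exact ⟨y, y.2, fun x hx => hy ⟨x, hx⟩⟩

theorem IsKreinForm.neg (hB : IsKreinForm B) : IsKreinForm (-B) where
  hermitian x y := by simp [hB.hermitian x y]
  continuous := hB.continuous.neg
  decomposition := by
    obtain ⟨P, N, hPN, horth, hP, hN⟩ := hB.decomposition
    refine ⟨N, P, hPN.symm, fun x hx y hy => ?_, hN, by rwa [neg_neg]⟩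
    simp [hB.hermitian y x, horth y hy x hx]

/-- Every continuous functional on a Krein space is represented by the form. -/
theorem IsKreinForm.exists_repr [CompleteSpace K] (hB : IsKreinForm B) (f : K →L[ℂ] ℂ) :
    ∃ y, ∀ x, f x = B y x := by
  obtain ⟨P, N, hPN, horth, hP, hN⟩ := hB.decomposition
  have horth' : ∀ x ∈ N, ∀ y ∈ P, B x y = 0 := fun x hx y hy => by
    simp [hB.hermitian y x, horth y hy x hx]
  obtain ⟨p, hp, hfp⟩ := hB.exists_repr_on_hilbertSubspace hPN horth hP hN f
  obtain ⟨n, hn, hfn⟩ := hB.neg.exists_repr_on_hilbertSubspace hPN.symm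
    (fun x hx y hy => by simp [horth' x hx y hy]) hN (by rwa [neg_neg]) f
  -- The minus sign appears because `n` represents `f` on `N` with respect to `-B`.
  refine ⟨p - n, fun x => ?_⟩
  obtain ⟨a, ha, b, hb, rfl⟩ := Submodule.mem_sup.1
    (hPN.sup_eq_top ▸ Submodule.mem_top : x ∈ P ⊔ N)
  have h1 := horth p hp b hb
  have h2 := horth' n hn a ha
  rw [map_add, hfp a ha, hfn b hb]
  simp [h1, h2, sub_eq_add_neg]

theorem IsKreinForm.eq_zero_of_forall (hB : IsKreinForm B) {z : K} (h : ∀ x, B x z = 0) :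
    z = 0 := by
  obtain ⟨P, N, hPN, horth, hP, hN⟩ := hB.decomposition
  obtain ⟨p, hp, n, hn, rfl⟩ := Submodule.mem_sup.1
    (hPN.sup_eq_top ▸ Submodule.mem_top : z ∈ P ⊔ N)
  have h1 := h p
  rw [map_add, horth p hp n hn, add_zero] at h1
  have h2 := h n
  rw [map_add, hB.hermitian p n, horth p hp n hn, map_zero, zero_add] at h2
  have hp0 : p = 0 := by
    by_contra h0
    have := hP.pos p hp h0
    simp [h1] at this
  have hn0 : n = 0 := by
    by_contra h0
    have := hN.pos n hn h0
    simp [h2] at this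
  rw [hp0, hn0, add_zero]

theorem IsKreinForm.eq_zero_of_dense (hB : IsKreinForm B) {D : Set K} (hD : Dense D) {z : K}
    (h : ∀ x ∈ D, B x z = 0) : z = 0 :=
  hB.eq_zero_of_forall fun x => by
    have h1 : Continuous fun x => B x z := hB.continuous.comp (Continuous.prodMk_left z)
    exact congrFun (h1.ext_on hD continuous_const h) x

/-- By Hahn–Banach, applied in the quotient by the closure of `M`, it suffices that functionals
vanishing on `M` are zero; each of them is some `[y, ·]`. -/
theorem IsKreinForm.dense_of_orthogonal [CompleteSpace K] (hB : IsKreinForm B)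
    (M : Submodule ℂ K) (h : ∀ y, (∀ x ∈ M, B y x = 0) → y = 0) : Dense (M : Set K) := by
  rw [Submodule.dense_iff_topologicalClosure_eq_top, Submodule.eq_top_iff']
  intro x
  have : IsClosed (M.topologicalClosure : Set K) := M.isClosed_topologicalClosure
  rw [← Submodule.Quotient.mk_eq_zero]
  refine SeparatingDual.eq_zero_of_forall_dual_eq_zero (R := ℂ) fun g => ?_
  obtain ⟨y, hy⟩ := hB.exists_repr (g ∘L M.topologicalClosure.mkQL)
  have hy0 : y = 0 := h y fun w hw => by
    rw [← hy w]
    have : M.topologicalClosure.mkQL w = 0 :=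
      (Submodule.Quotient.mk_eq_zero _).2 (M.le_topologicalClosure hw)
    simp only [ContinuousLinearMap.comp_apply, this, map_zero]
  have := hy x
  rwa [hy0, map_zero] at this

/-! ### Adjoints and selfadjointness -/

/-- Density of `dom T` and nondegeneracy make the adjoint relation single-valued, so `toLinearPMap`
keeps its graph. -/
theorem IsKreinForm.graph_adjoint (hB : IsKreinForm B) {T : K →ₗ.[ℂ] K}
    (hT : Dense (T.domain : Set K)) : (adjoint B T).graph = adjointGraph B T := by
  refine Submodule.toLinearPMap_graph_eq _ fun p hp hp0 => hB.eq_zero_of_dense hT fun x hx => ?_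
  have : B (T ⟨x, hx⟩) p.1 = B x p.2 := hp ⟨x, hx⟩
  rw [← this, hp0, map_zero]

theorem IsKreinForm.isClosed_adjoint (hB : IsKreinForm B) {T : K →ₗ.[ℂ] K}
    (hT : Dense (T.domain : Set K)) : (adjoint B T).IsClosed := by
  rw [LinearPMap.IsClosed, hB.graph_adjoint hT]
  have : (adjointGraph B T : Set (K × K)) =
      ⋂ x : T.domain, {p | B (T x) p.1 = B x p.2} := by
    ext p
    simp only [Set.mem_iInter]
    rfl
  rw [this]
  exact isClosed_iInter fun x => isClosed_eq
    (hB.continuous.comp (continuous_const.prodMk continuous_fst))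
    (hB.continuous.comp (continuous_const.prodMk continuous_snd))

theorem IsKreinForm.isFormalAdjoint_adjoint (hB : IsKreinForm B) {T : K →ₗ.[ℂ] K}
    (hT : Dense (T.domain : Set K)) : IsFormalAdjoint B T (adjoint B T) := by
  intro x u y v hx hy
  rw [hB.graph_adjoint hT] at hy
  obtain ⟨a, rfl, rfl⟩ := (LinearPMap.mem_graph_iff _).1 hx
  exact hy a

theorem IsFormalAdjoint.mul_self (hB : IsKreinForm B) {T S : K →ₗ.[ℂ] K}
    (h : IsFormalAdjoint B T S) : IsFormalAdjoint B (mul T S) (mul T S) := by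
  intro x u y v hx hy
  obtain ⟨a, hxa, hau⟩ := mem_graph_mul.1 hx
  obtain ⟨b, hyb, hbv⟩ := mem_graph_mul.1 hy
  rw [h hau hyb, h.symm hB hxa hbv]

/-- A symmetric operator whose resolvent set contains a pair of conjugate points is
selfadjoint. -/
theorem IsKreinForm.isSelfadjoint [CompleteSpace K] (hB : IsKreinForm B) {C : K →ₗ.[ℂ] K}
    (hC : IsFormalAdjoint B C C) {z : ℂ} (hz : z ∈ resolventSet C)
    (hz' : (starRingEnd ℂ) z ∈ resolventSet C) : IsSelfadjoint B C := by
  obtain ⟨R, hR⟩ := hz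
  obtain ⟨R', hR'⟩ := hz'
  have hdense : Dense (C.domain : Set K) := by
    refine hB.dense_of_orthogonal _ fun y hy => ?_
    -- Symmetry gives `[x, R y] = [R' x, y]`, which vanishes because `R' x` lies in the domain.
    have hR0 : R y = 0 := hB.eq_zero_of_forall fun x => by
      have h1 := hC (hR'.mem_graph x) (hR.mem_graph y)
      have h2 : B y (R' x) = 0 := hy _ (LinearPMap.mem_domain_of_mem_graph (hR'.mem_graph x))
      have h3 : B (R' x) y = 0 := by rw [hB.hermitian y, h2, map_zero]
      simpa [h3] using h1
    have h1 := hR.mem_graph y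
    rw [hR0, smul_zero, add_zero] at h1
    exact C.graph_fst_eq_zero_snd h1 rfl
  refine ⟨hdense, LinearPMap.eq_of_eq_graph ?_⟩
  rw [hB.graph_adjoint hdense]
  ext ⟨y, w⟩
  constructor
  · intro hyw
    have hyw' : ∀ x u, (x, u) ∈ C.graph → B u y = B x w := fun x u hx => by
      obtain ⟨a, rfl, rfl⟩ := (LinearPMap.mem_graph_iff _).1 hx
      exact hyw a
    have hg := hR'.mem_graph (w - (starRingEnd ℂ) z • y)
    set y' := R' (w - (starRingEnd ℂ) z • y) with hy'
    -- Both `y` and `y'` are tested against `R x`. The difference of the two identities is `[x, y -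
    -- y'] = 0`, since the terms with `z` cancel.
    have h0 : y - y' = 0 := hB.eq_zero_of_forall fun x => by
      have h1 := hyw' _ _ (hR.mem_graph x)
      have h2 := hC (hR.mem_graph x) hg
      simp only [map_add, map_sub, map_smul, map_smulₛₗ, LinearMap.add_apply,
        LinearMap.smul_apply, smul_eq_mul] at h1 h2 ⊢
      linear_combination h1 - h2
    rw [← sub_eq_zero.1 h0] at hg
    simpa using hg
  · intro hyw x
    exact hC (C.mem_graph x) hyw

end Krein

namespace Krein

open Filter Topology

/-! ### Neighbourhoods in the extended real line -/

/-- Without 0 and ∞ the extended line splits into two disjoint open half-lines, and a connected set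
lies in one of them. -/
theorem mul_pos_of_isPreconnected {s : Set (OnePoint ℝ)} (hs : IsPreconnected s)
    (h0 : ((0 : ℝ) : OnePoint ℝ) ∉ s) (hi : OnePoint.infty ∉ s) {a b : ℝ}
    (ha : (a : OnePoint ℝ) ∈ s) (hb : (b : OnePoint ℝ) ∈ s) : 0 < a * b := by
  have hsub : s ⊆ (fun t : ℝ => (t : OnePoint ℝ)) '' Set.Ioi 0 ∪
      (fun t : ℝ => (t : OnePoint ℝ)) '' Set.Iio 0 := by
    intro x hx
    induction x using OnePoint.rec with
    | infty => exact absurd hx hi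
    | coe t =>
      rcases lt_trichotomy t 0 with h | rfl | h
      · exact Or.inr ⟨t, h, rfl⟩
      · exact absurd hx h0
      · exact Or.inl ⟨t, h, rfl⟩
  have hdisj : Disjoint ((fun t : ℝ => (t : OnePoint ℝ)) '' Set.Ioi 0)
      ((fun t : ℝ => (t : OnePoint ℝ)) '' Set.Iio 0) :=
    (Set.disjoint_image_iff OnePoint.coe_injective).2
      (Set.disjoint_left.2 fun t (h : 0 < t) h' => lt_asymm h h')
  rcases IsPreconnected.subset_or_subset (OnePoint.isOpen_image_coe.2 isOpen_Ioi)
    (OnePoint.isOpen_image_coe.2 isOpen_Iio) hdisj hsub hs with h | h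
  all_goals
    obtain ⟨a', ha', hae⟩ := h ha
    obtain ⟨b', hb', hbe⟩ := h hb
    obtain rfl := OnePoint.coe_injective hae
    obtain rfl := OnePoint.coe_injective hbe
  · exact mul_pos ha' hb'
  · exact mul_pos_of_neg_of_neg ha' hb'

theorem isConnected_insert_infty {s : Set ℝ} (hs : IsConnected s) {l : Filter ℝ} [l.NeBot]
    (hl : l ≤ cocompact ℝ) (hsl : s ∈ l) :
    IsConnected (insert OnePoint.infty ((fun t : ℝ => (t : OnePoint ℝ)) '' s)) := by
  refine (hs.image _ OnePoint.continuous_coe.continuousOn).subset_closure (Set.subset_insert _ _)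
    (Set.insert_subset ?_ subset_closure)
  have : Tendsto (fun t : ℝ => (t : OnePoint ℝ)) l (𝓝 OnePoint.infty) :=
    OnePoint.tendsto_coe_infty.mono_left (by rwa [coclosedCompact_eq_cocompact])
  exact mem_closure_of_tendsto this (mem_of_superset hsl fun t ht => ⟨t, ht, rfl⟩)

theorem exists_isConnected_punctured_subset {p : OnePoint ℝ} {I : Set (OnePoint ℝ)}
    (hI : IsOpen I) (hp : p ∈ I) : ∃ J ⊆ I, IsOpen J ∧ IsConnected J ∧ p ∈ J ∧
      ((0 : ℝ) : OnePoint ℝ) ∉ J \ {p} ∧ OnePoint.infty ∉ J \ {p} := by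
  induction p using OnePoint.rec with
  | infty =>
    have hc := ((OnePoint.isOpen_iff_of_mem hp).1 hI).2
    obtain ⟨r, hr0, hr⟩ : ∃ r : ℝ, 0 ≤ r ∧
        ((fun t : ℝ => (t : OnePoint ℝ)) ⁻¹' I)ᶜ ⊆ Set.Icc (-r) r := by
      obtain ⟨r, hr0, hr⟩ := hc.isBounded.subset_closedBall_lt 0 0
      refine ⟨r, hr0.le, hr.trans ?_⟩
      rw [Real.closedBall_eq_Icc, zero_sub, zero_add]
    -- The removed interval contains the compact set missed by `I`, and also 0 because `r ≥ 0`. What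
    -- is left is two rays joined at ∞.
    refine ⟨((fun t : ℝ => (t : OnePoint ℝ)) '' Set.Icc (-r) r)ᶜ, ?_,
      OnePoint.isOpen_compl_image_coe.2 ⟨isClosed_Icc, isCompact_Icc⟩, ?_,
      OnePoint.infty_notMem_image_coe, fun h => h.1 ⟨0, by simpa using hr0, rfl⟩, fun h => h.2 rfl⟩
    · intro x hx
      induction x using OnePoint.rec with
      | infty => exact hp
      | coe t =>
        by_contra h
        exact hx ⟨t, hr h, rfl⟩
    · have e : ((fun t : ℝ => (t : OnePoint ℝ)) '' Set.Icc (-r) r)ᶜ =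
          insert OnePoint.infty ((fun t : ℝ => (t : OnePoint ℝ)) '' Set.Ioi r) ∪
          insert OnePoint.infty ((fun t : ℝ => (t : OnePoint ℝ)) '' Set.Iio (-r)) := by
        ext x
        induction x using OnePoint.rec with
        | infty => simp
        | coe t =>
          simp only [Set.mem_compl_iff, Set.mem_image, OnePoint.coe_eq_coe, exists_eq_right,
            Set.mem_Icc, Set.mem_union, Set.mem_insert_iff, OnePoint.coe_ne_infty, false_or,
            Set.mem_Ioi, Set.mem_Iio, not_and_or, not_le]
          exact or_comm
      rw [e]
      exact (isConnected_insert_infty isConnected_Ioi atTop_le_cocompact (Ioi_mem_atTop r)).union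
        ⟨_, Set.mem_insert _ _, Set.mem_insert _ _⟩
        (isConnected_insert_infty isConnected_Iio atBot_le_cocompact (Iio_mem_atBot (-r)))
  | coe a =>
    have h1 : (fun t : ℝ => (t : OnePoint ℝ)) ⁻¹' I ∈ 𝓝 a :=
      (hI.preimage OnePoint.continuous_coe).mem_nhds hp
    -- The set `{0} \ {a}` is empty when `a = 0`, so both cases are treated at once.
    have h2 : ({0} \ {a} : Set ℝ)ᶜ ∈ 𝓝 a :=
      ((Set.finite_singleton (0 : ℝ)).sdiff.isClosed.isOpen_compl).mem_nhds fun h => h.2 rfl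
    obtain ⟨ε, hε, hsub⟩ := Metric.mem_nhds_iff.1 (inter_mem h1 h2)
    refine ⟨(fun t : ℝ => (t : OnePoint ℝ)) '' Metric.ball a ε, ?_,
      OnePoint.isOpen_image_coe.2 Metric.isOpen_ball,
      ((convex_ball a ε).isConnected ⟨a, Metric.mem_ball_self hε⟩).image _
        OnePoint.continuous_coe.continuousOn, ⟨a, Metric.mem_ball_self hε, rfl⟩, ?_,
      fun h => OnePoint.infty_notMem_image_coe h.1⟩
    · rintro _ ⟨t, ht, rfl⟩
      exact (hsub ht).1
    · rintro ⟨⟨t, ht, hte⟩, hne⟩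
      obtain rfl := OnePoint.coe_injective hte
      exact (hsub ht).2 ⟨rfl, fun h => hne (congrArg _ h)⟩

theorem im_ne_zero_of_notMem_range_extReal {z : ℂ}
    (h : (z : OnePoint ℂ) ∉ Set.range extReal) : z.im ≠ 0 := fun h0 =>
  h ⟨(z.re : ℝ), congrArg (fun w : ℂ => (w : OnePoint ℂ)) (Complex.ext rfl h0.symm)⟩

theorem notMem_range_extReal {z : ℂ} (h : z.im ≠ 0) : (z : OnePoint ℂ) ∉ Set.range extReal := by
  rintro ⟨p, hp⟩
  induction p using OnePoint.rec with
  | infty => exact OnePoint.infty_ne_coe z hp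
  | coe t =>
    obtain rfl : (t : ℂ) = z := OnePoint.coe_injective hp
    exact h (Complex.ofReal_im t)

/-! ### Local definitizability of `S T` and `T S` -/

variable {K : Type*} [NormedAddCommGroup K] [NormedSpace ℂ K]
variable {B : K →ₗ⋆[ℂ] K →ₗ[ℂ] ℂ} {T S : K →ₗ.[ℂ] K} {Ω : Set (OnePoint ℂ)}

/-- The growth condition at a single real point `t` of `Ω` puts `t ± iε/2` into the resolvent set
for some `ε > 0`. -/
theorem IsDefinitizableOver.exists_conj_mem_resolventSet {A : K →ₗ.[ℂ] K}
    (hA : IsDefinitizableOver B A Ω) (hΩ : IsAdmissibleDomain Ω) :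
    ∃ z : ℂ, z ≠ 0 ∧ z ∈ resolventSet A ∧ (starRingEnd ℂ) z ∈ resolventSet A := by
  obtain ⟨t, ht⟩ := hΩ.meets_real
  obtain ⟨U, hU, hΔ, m, -, M, -, H⟩ := hA.growth {((t : ℂ) : OnePoint ℂ)} isClosed_singleton
    (Set.singleton_subset_iff.2 ⟨ht, (t : OnePoint ℝ), rfl⟩)
  have htU : (t : ℂ) ∈ (fun z : ℂ => (z : OnePoint ℂ)) ⁻¹' U :=
    hΔ (Set.mem_singleton _)
  obtain ⟨ε, hε, hball⟩ := Metric.mem_nhds_iff.1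
    ((hU.preimage OnePoint.continuous_coe).mem_nhds htU)
  have key : ∀ z : ℂ, z.re = t → |z.im| = ε / 2 → z ∈ resolventSet A := fun z h1 h2 => by
    refine (H z ⟨hball ?_, notMem_range_extReal fun h => ?_⟩).1
    · have : z - t = z.im * Complex.I := by
        apply Complex.ext <;> simp [h1]
      rw [mem_ball_iff_norm, this, norm_mul, Complex.norm_I, mul_one, Complex.norm_real,
        Real.norm_eq_abs, h2]
      linarith
    · rw [h, abs_zero] at h2
      linarith
  have hab : |ε / 2| = ε / 2 := abs_of_pos (by positivity)
  refine ⟨⟨t, ε / 2⟩, fun h => ?_, key _ rfl hab, key _ rfl ?_⟩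
  · have := congrArg Complex.im h
    simp only [Complex.zero_im] at this
    linarith
  · simpa using hab

/-- The number `a` records the common sign of the points of `s`: for `a > 0` the type is kept, for
`a < 0` positive and negative type are exchanged. -/
theorem ResolventFactors.isOfDefiniteType {μ ν μ' ν' : ℂ} {Q F G Q' F' G' : K →L[ℂ] K}
    (h : ResolventFactors T S μ ν Q F G) (h' : ResolventFactors S T μ' ν' Q' F' G')
    (hB : IsKreinForm B) (hTS : IsFormalAdjoint B T S) {s : Set ℝ} {a : ℝ} (ha : a ≠ 0)
    (hs : ∀ t ∈ s, 0 < a * t)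
    (hA : IsOfDefiniteType B (mul S T) ((fun t : ℝ => (t : ℂ)) '' s)) :
    IsOfDefiniteType B (mul T S) ((fun t : ℝ => (t : ℂ)) '' s) := by
  have key : ∀ ε : ℝ, (fun t : ℝ => (t : ℂ)) '' s ∩ spectrum (mul S T) ⊆
      signTypeSpectrum B ε (mul S T) → ∀ t ∈ s, (t : ℂ) ∈ spectrum (mul T S) →
      (t : ℂ) ∈ signTypeSpectrum B (ε * t) (mul T S) := fun ε hε t ht hσ => by
    have ht0 : t ≠ 0 := right_ne_zero_of_mul (hs t ht).ne'
    exact h.mem_signTypeSpectrum h' hB hTS ht0 (hε ⟨⟨t, ht, rfl⟩, fun hC =>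
      hσ (h.mem_resolventSet (by exact_mod_cast ht0) hC)⟩)
  rcases lt_or_gt_of_ne ha with ha | ha
  · have hneg : ∀ t ∈ s, t < 0 := fun t ht => neg_of_mul_pos_right (hs t ht) ha.le
    rcases hA with hA | hA
    · rw [posTypeSpectrum_eq hB one_pos] at hA
      right
      rintro _ ⟨⟨t, ht, rfl⟩, hσ⟩
      rw [negTypeSpectrum_eq hB (ε := 1 * t) (by simpa using hneg t ht)]
      exact key 1 hA t ht hσ
    · rw [negTypeSpectrum_eq hB (neg_lt_zero.2 one_pos)] at hA
      left
      rintro _ ⟨⟨t, ht, rfl⟩, hσ⟩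
      rw [posTypeSpectrum_eq hB (ε := -1 * t) (by simpa using hneg t ht)]
      exact key (-1) hA t ht hσ
  · have hpos : ∀ t ∈ s, 0 < t := fun t ht => pos_of_mul_pos_right (hs t ht) ha.le
    rcases hA with hA | hA
    · rw [posTypeSpectrum_eq hB one_pos] at hA
      left
      rintro _ ⟨⟨t, ht, rfl⟩, hσ⟩
      rw [posTypeSpectrum_eq hB (ε := 1 * t) (by simpa using hpos t ht)]
      exact key 1 hA t ht hσ
    · rw [negTypeSpectrum_eq hB (neg_lt_zero.2 one_pos)] at hA
      right
      rintro _ ⟨⟨t, ht, rfl⟩, hσ⟩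
      rw [negTypeSpectrum_eq hB (ε := -1 * t) (by simpa using hpos t ht)]
      exact key (-1) hA t ht hσ

theorem IsOfDefiniteType.mono {A : K →ₗ.[ℂ] K} {Δ Δ' : Set ℂ} (h : IsOfDefiniteType B A Δ)
    (hΔ : Δ' ⊆ Δ) : IsOfDefiniteType B A Δ' :=
  h.imp (Set.inter_subset_inter_left _ hΔ).trans (Set.inter_subset_inter_left _ hΔ).trans

/-- For closed operators `T` and `S` that are formally adjoint to each other, definitizability
over `Ω` of `S T` implies that of `T S`. -/
theorem IsDefinitizableOver.swap [CompleteSpace K] (hB : IsKreinForm B) (hT : T.IsClosed)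
    (hS : S.IsClosed) (hTS : IsFormalAdjoint B T S) (h₁ : (resolventSet (mul S T)).Nonempty)
    (h₂ : (resolventSet (mul T S)).Nonempty) (hΩ : IsAdmissibleDomain Ω)
    (hA : IsDefinitizableOver B (mul S T) Ω) : IsDefinitizableOver B (mul T S) Ω := by
  obtain ⟨μ, ν, Q, F, G, h⟩ := exists_resolventFactors hT hS h₁ h₂
  obtain ⟨μ', ν', Q', F', G', h'⟩ := exists_resolventFactors hS hT h₂ h₁
  have hσ : ∀ z : ℂ, z ≠ 0 → (z ∈ spectrum (mul T S) ↔ z ∈ spectrum (mul S T)) := fun z hz =>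
    not_congr ⟨h'.mem_resolventSet hz, h.mem_resolventSet hz⟩
  have hne : ∀ z : ℂ, (z : OnePoint ℂ) ∉ Set.range extReal → z ≠ 0 := fun z hz h0 =>
    im_ne_zero_of_notMem_range_extReal hz (by rw [h0, Complex.zero_im])
  refine ⟨?_, fun p hp => ?_, fun z hz hzΩ => ?_, fun Δ hΔ hΔΩ => ?_, fun p hp => ?_⟩
  · obtain ⟨z, hz, h1, h2⟩ := hA.exists_conj_mem_resolventSet hΩ
    exact hB.isSelfadjoint (hTS.mul_self hB) (h.mem_resolventSet hz h1)
      (h.mem_resolventSet ((map_ne_zero _).2 hz) h2)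
  · have e : (fun z : ℂ => (z : OnePoint ℂ)) '' spectrum (mul T S) ∩ (Ω \ Set.range extReal) =
        (fun z : ℂ => (z : OnePoint ℂ)) '' spectrum (mul S T) ∩ (Ω \ Set.range extReal) := by
      ext w
      refine and_congr_left fun hw => exists_congr fun z => and_congr_left fun hzw => ?_
      exact hσ z (hne z (by subst hzw; exact hw.2))
    rw [e]
    exact hA.no_accPt p hp
  · have hz0 := hne z hzΩ.2
    exact h.isResolventPole h' hz0 (hA.poles z ((hσ z hz0).1 hz) hzΩ)
  · obtain ⟨U, hU, hΔU, m, hm, M, hM, H⟩ := hA.growth Δ hΔ hΔΩ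
    obtain ⟨M', hM', H'⟩ := h.growth hm hM
    refine ⟨U, hU, hΔU, m + 1, by omega, M', hM', fun z hz => ?_⟩
    obtain ⟨hρ, hle⟩ := H z hz
    exact ⟨h.mem_resolventSet (hne z hz.2) hρ,
      H' z (im_ne_zero_of_notMem_range_extReal hz.2) hρ hle⟩
  · obtain ⟨I, hI, -, hpI, HI⟩ := hA.definite p hp
    -- Components of `J \ {p}` contain neither 0 nor ∞, so all their points have the same sign, and
    -- each lies in a component of `I \ {p}`.
    obtain ⟨J, hJI, hJ, hJc, hpJ, hJ0, hJi⟩ := exists_isConnected_punctured_subset hI hpI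
    refine ⟨J, hJ, hJc, hpJ, fun q hq => ?_⟩
    have hsub : J \ {p} ⊆ I \ {p} := Set.sdiff_subset_sdiff_left hJI
    set D := connectedComponentIn (J \ {p}) q with hD
    have hDJ : D ⊆ J \ {p} := connectedComponentIn_subset _ _
    have hqD : q ∈ D := mem_connectedComponentIn hq
    have e : {z : ℂ | ∃ t : ℝ, (t : ℂ) = z ∧ (t : OnePoint ℝ) ∈ D} =
        (fun t : ℝ => (t : ℂ)) '' {t : ℝ | (t : OnePoint ℝ) ∈ D} := by
      ext z
      exact exists_congr fun t => and_comm
    rw [e]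
    induction q using OnePoint.rec with
    | infty => exact absurd hq hJi
    | coe a =>
      have hpos : ∀ t ∈ {t : ℝ | (t : OnePoint ℝ) ∈ D}, 0 < a * t := fun t ht =>
        mul_pos_of_isPreconnected isPreconnected_connectedComponentIn (fun h => hJ0 (hDJ h))
          (fun h => hJi (hDJ h)) hqD ht
      refine h.isOfDefiniteType h' hB hTS (left_ne_zero_of_mul (hpos a hqD).ne') hpos ?_
      refine (HI _ (hsub hq)).mono ?_
      rw [← e]
      rintro z ⟨t, rfl, ht⟩
      exact ⟨t, rfl, connectedComponentIn_mono _ hsub ht⟩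

end Krein

theorem theoremt {K : Type*} [NormedAddCommGroup K] [NormedSpace ℂ K] [CompleteSpace K]
    (B : K →ₗ⋆[ℂ] K →ₗ[ℂ] ℂ) (hB : Krein.IsKreinForm B)
    (T : K →ₗ.[ℂ] K) (hT_closed : T.IsClosed) (hT_dense : Dense (T.domain : Set K))
    (h₁ : (Krein.resolventSet (Krein.mul (Krein.adjoint B T) T)).Nonempty)
    (h₂ : (Krein.resolventSet (Krein.mul T (Krein.adjoint B T))).Nonempty)
    (Ω : Set (OnePoint ℂ)) (hΩ : Krein.IsAdmissibleDomain Ω) :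
    Krein.IsDefinitizableOver B (Krein.mul (Krein.adjoint B T) T) Ω ↔
      Krein.IsDefinitizableOver B (Krein.mul T (Krein.adjoint B T)) Ω := by
  have hTS := hB.isFormalAdjoint_adjoint hT_dense
  have hS := hB.isClosed_adjoint hT_dense
  -- Only closedness and formal adjointness enter, and both are symmetric in the pair, so the
  -- converse does not require `T` to equal its second adjoint.
  exact ⟨fun h => h.swap hB hT_closed hS hTS h₁ h₂ hΩ,
    fun h => h.swap hB hS hT_closed (hTS.symm hB) h₂ h₁ hΩ⟩
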